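/- **Theorem.** Let $n \ge 1$ and $0 \le m \le n$ be integers. Let $\alpha$ and $\beta$ be two independent, uniformly random $n$-cycles on $[n] = \{1, \dots, n\}$, that is, permutations of $[n]$ consisting of a single cycle of length $n$ (for $n=1$, the identity). Let $\sigma^{(n)}_m$ be the probability that the elements of $[m] = \{1, \dots, m\}$ lie in pairwise distinct cycles of the product $\alpha\beta$, where fixed points count as cycles of length one. Then $$ \sigma^{(n)}_m = \begin{cases} \dfrac{1}{m!}, & \text{if } n-m \text{ is odd},\\[2ex] \dfrac{1}{m!} + \dfrac{2}{(m-2)!\,(n+1-m)(n+m)}, & \text{if } n-m \text{ is even}, \end{cases} $$ where, for $m \in \{0,1\}$, the expression $\dfrac{1}{(m-2)!}$ is read as $0$. -/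

import Mathlib

noncomputable section

open Classical in
/-- The `n`-cycles on the `n`-element ground set `Fin n` (in the role of `{1, …, n}`): the
permutations having a single orbit. For `n = 1` this is the identity. -/
def nCycles (n : ℕ) : Finset (Equiv.Perm (Fin n)) :=
  Finset.univ.filter fun s => s.IsCycleOn Set.univ

/-- `w` separates `[m]`: distinct elements among the first `m` ones lie in distinct cycles of `w`
(fixed points count as cycles of length one). -/
def Separates {n : ℕ} (m : ℕ) (w : Equiv.Perm (Fin n)) : Prop :=
  ∀ i j : Fin n, i.val < m → j.val < m → i ≠ j → ¬ w.SameCycle i j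

open Classical in
/-- The probability that `[m]` is separated by the product of two independent, uniformly
distributed `n`-cycles. -/
def separationProbability (n m : ℕ) : ℚ :=
  (((nCycles n ×ˢ nCycles n).filter fun p => Separates m (p.1 * p.2)).card : ℚ) /
    ((nCycles n ×ˢ nCycles n).card : ℚ)

/-- `1 / k!` for an integer `k`, with the usual convention `1 / k! = 0` for `k < 0`. -/
def invFactorial (k : ℤ) : ℚ :=
  if k < 0 then 0 else 1 / (k.toNat.factorial : ℚ)

end

/-! Setting `u = α⁻¹` and `w = αβ`, the pairs to be counted correspond to a separating `w` together
with a long cycle `u` for which `u * w` is again a long cycle. Both conditions are handled through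
signs of restrictions to subsets `U`.

For fixed `w`, a principal minor of `1 - P_w` detects long cycles, and expanding it by rows writes
the indicator as a combination of restricted signs (`card_mul_indicator_longCycles`). Averaging
`restrictedSign U (u * w)` over all long cycles `u` gives a function of `w` that transforms on both
sides by the sign on `U` under the stabilizer of `U`, and that vanishes on this stabilizer when `U`
is proper and nonempty. Such functions form a line, spanned by `crossSign U`
(`longSign_eq_mul_crossSign`). Hence the number of `u` is a linear functional, with weights `k! (d -
k)!` where `d = n - 1`, of the coefficients of `n X det (1 + X P_w) / (1 + X)`
(`card_sq_mul_sum_indicator`).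

It remains to sum `det (1 + X P_w)` over the separating `w`. Inserting the points outside `[m]` one
at a time into cycles yields a first-order recursion, and the sum is `(1 + X) ^ m` times a
polynomial with explicit coefficients (`sum_signPoly_separating`, `coeff_separatingCofactor`). The
weights are Beta integrals, under which powers of `1 + X` are absorbed, and the remaining sum
telescopes (`mul_betaSum_separatingCofactor`). -/

section

open Finset Equiv

/-! ### Signs of restrictions of permutations, as determinants -/

section RestrictedSign

variable {α : Type*} [Fintype α] [DecidableEq α]

/-- The `0`-`1` matrix of a self-map `f`, with a one at each position `(i, f i)`. -/
def selfMapMatrix (R : Type*) [Zero R] [One R] (f : α → α) : Matrix α α R :=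
  fun i j => if f i = j then 1 else 0

/-- The map that agrees with `w` on `U` and fixes everything else. -/
def restrictMap (U : Finset α) (w : Perm α) (i : α) : α := if i ∈ U then w i else i

/-- The sign of the restriction of `w` to `U` if `w` preserves `U`, and zero otherwise. -/
def restrictedSign (U : Finset α) (w : Perm α) : ℚ := (selfMapMatrix ℚ (restrictMap U w)).det

theorem selfMapMatrix_mul (f g : α → α) :
    selfMapMatrix ℚ f * selfMapMatrix ℚ g = selfMapMatrix ℚ (g ∘ f) := by
  ext i j
  rw [Matrix.mul_apply, Finset.sum_eq_single (f i)]
  · simp [selfMapMatrix]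
  · intro k _ hk
    simp [selfMapMatrix, hk.symm]
  · simp

theorem det_selfMapMatrix_perm (w : Perm α) : (selfMapMatrix ℚ w).det = (Perm.sign w : ℤ) := by
  rw [← Matrix.det_permutation]
  congr 1
  ext i j
  simp [selfMapMatrix, Equiv.toPEquiv_apply]

theorem det_selfMapMatrix_of_eq {f : α → α} {i j : α} (h : i ≠ j) (hf : f i = f j) :
    (selfMapMatrix ℚ f).det = 0 :=
  Matrix.det_zero_of_row_eq h (by funext k; simp [selfMapMatrix, hf])

/-- The restricted map takes the value `w i` both at `i` and at the fixed point `w i`, so two rows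
agree. -/
theorem restrictedSign_eq_zero {U : Finset α} {w : Perm α} {i : α} (hi : i ∈ U)
    (hw : w i ∉ U) : restrictedSign U w = 0 :=
  det_selfMapMatrix_of_eq (i := i) (j := w i) (fun h => hw (h ▸ hi)) (by simp [restrictMap, hi, hw])

theorem restrictedSign_mul_right {U : Finset α} {p : Perm α} (hp : ∀ i ∈ U, p i ∈ U)
    (w : Perm α) : restrictedSign U (w * p) = restrictedSign U w * restrictedSign U p := by
  rw [mul_comm, restrictedSign, restrictedSign, restrictedSign, ← Matrix.det_mul, selfMapMatrix_mul]
  congr 2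
  funext i
  by_cases hi : i ∈ U <;> simp [restrictMap, hi, hp]

omit [Fintype α] in
theorem preserves_iff {U : Finset α} {p : Perm α} (hp : ∀ i ∈ U, p i ∈ U) (i : α) :
    p i ∈ U ↔ i ∈ U := by
  refine ⟨fun h => ?_, hp i⟩
  have : U.image p = U := Finset.eq_of_subset_of_card_le
    (by simpa [Finset.image_subset_iff] using hp) (by rw [card_image_of_injective _ p.injective])
  rw [← this, mem_image] at h
  obtain ⟨j, hj, hji⟩ := h
  rwa [← p.injective hji]

theorem restrictedSign_mul_left {U : Finset α} {p : Perm α} (hp : ∀ i ∈ U, p i ∈ U)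
    (w : Perm α) : restrictedSign U (p * w) = restrictedSign U p * restrictedSign U w := by
  by_cases hw : ∀ i ∈ U, w i ∈ U
  · rw [restrictedSign_mul_right hw]
  · push Not at hw
    obtain ⟨i, hi, hwi⟩ := hw
    rw [restrictedSign_eq_zero hi hwi, mul_zero]
    exact restrictedSign_eq_zero hi (by simpa [preserves_iff hp] using hwi)

theorem restrictedSign_empty (w : Perm α) : restrictedSign ∅ w = 1 := by
  have : restrictMap ∅ w = (1 : Perm α) := by funext i; simp [restrictMap]
  rw [restrictedSign, this, det_selfMapMatrix_perm]; simp

theorem restrictedSign_eq_one {U : Finset α} {w : Perm α} (h : ∀ i ∈ U, w i = i) :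
    restrictedSign U w = 1 := by
  have : restrictMap U w = (1 : Perm α) := by
    funext i; by_cases hi : i ∈ U <;> simp [restrictMap, hi, h]
  rw [restrictedSign, this, det_selfMapMatrix_perm]; simp

theorem restrictedSign_one (U : Finset α) : restrictedSign U 1 = 1 :=
  restrictedSign_eq_one (by simp)

theorem restrictedSign_insert {U : Finset α} {w : Perm α} {z : α} (hz : w z = z) :
    restrictedSign (insert z U) w = restrictedSign U w := by
  rw [restrictedSign, restrictedSign]
  congr 2
  funext i
  by_cases hi : i = z
  · subst hi; simp [restrictMap, hz]
  · simp [restrictMap, hi]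

omit [Fintype α] in
theorem swap_preserves {U : Finset α} {x y : α} (hx : x ∈ U) (hy : y ∈ U) :
    ∀ i ∈ U, swap x y i ∈ U := by
  intro i hi
  rw [swap_apply_def]
  split_ifs <;> assumption

omit [Fintype α] in
theorem swap_preserves_of_notMem {U : Finset α} {x y : α} (hx : x ∉ U) (hy : y ∉ U) :
    ∀ i ∈ U, swap x y i = i := by
  intro i hi
  exact swap_apply_of_ne_of_ne (fun h => hx (h ▸ hi)) (fun h => hy (h ▸ hi))

theorem restrictedSign_swap {U : Finset α} {x y : α} (hx : x ∈ U) (hy : y ∈ U) (h : x ≠ y) :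
    restrictedSign U (swap x y) = -1 := by
  have : restrictMap U (swap x y) = swap x y := by
    funext i
    by_cases hi : i ∈ U
    · simp [restrictMap, hi]
    · rw [swap_apply_of_ne_of_ne (a := x) (b := y) (x := i) (fun h => hi (h ▸ hx)) (fun h => hi (h ▸ hy))]
      simp [restrictMap, hi]
  rw [restrictedSign, this, det_selfMapMatrix_perm, Perm.sign_swap h]; simp

theorem restrictedSign_conj (U : Finset α) (s w : Perm α) :
    restrictedSign (U.map s.toEmbedding) (s * w * s⁻¹) = restrictedSign U w := by
  rw [restrictedSign, restrictedSign, ← Matrix.det_submatrix_equiv_self s]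
  congr 1
  ext i j
  by_cases hi : i ∈ U <;> simp [selfMapMatrix, restrictMap, hi]

end RestrictedSign

/-! ### Row expansion of `det (A + q B)` -/

section RowExpansion

variable {α : Type*} [Fintype α] [DecidableEq α] {R : Type*} [CommRing R]

/-- The matrix with the rows of `B` at the positions in `U` and the rows of `A` elsewhere. -/
def mixRows (U : Finset α) (B A : Matrix α α R) : Matrix α α R :=
  fun i j => if i ∈ U then B i j else A i j

theorem det_add_smul (A B : Matrix α α R) (q : R) :
    (A + q • B).det = ∑ U : Finset α, q ^ U.card * (mixRows U B A).det := by
  have h := (Matrix.detRowAlternating (n := α) (R := R)).toMultilinearMap.map_add_univ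
    (fun i j => q * B i j) (fun i j => A i j)
  have e : (A + q • B) = ((fun i j => q * B i j) + fun i j => A i j) := by
    ext i j
    simp only [Matrix.add_apply, Matrix.smul_apply, smul_eq_mul, Pi.add_apply]
    exact add_comm _ _
  rw [e]
  refine h.trans (Finset.sum_congr rfl fun U _ => ?_)
  have h2 := (Matrix.detRowAlternating (n := α) (R := R)).toMultilinearMap.map_piecewise_smul
    (fun _ => q) (mixRows U B A) U
  rw [Finset.prod_const, smul_eq_mul] at h2
  refine Eq.trans ?_ h2
  congr 1
  funext i j
  by_cases hi : i ∈ U <;> simp [hi, mixRows, Finset.piecewise]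

/-- The factor `q` is moved into row `x`. That row then has no `A`-part, so only the sets `U`
containing `x` survive. -/
theorem mul_det_updateRow_add_smul (A B : Matrix α α R) (q : R) (x : α) (v : α → R) :
    q * ((A + q • B).updateRow x v).det =
      ∑ U : Finset α, if x ∈ U then q ^ U.card * ((mixRows U B A).updateRow x v).det else 0 := by
  have e : A.updateRow x 0 + q • B.updateRow x v = (A + q • B).updateRow x (q • v) := by
    ext i j
    by_cases hi : i = x
    · subst hi; simp
    · simp [hi]
  rw [← Matrix.det_updateRow_smul, ← e, det_add_smul]
  refine Finset.sum_congr rfl fun U _ => ?_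
  split_ifs with hx
  · congr 2
    ext i j
    by_cases hi : i = x
    · subst hi; simp [hx, mixRows]
    · by_cases hU : i ∈ U <;> simp [hi, hU, mixRows]
  · rw [Matrix.det_eq_zero_of_row_eq_zero x (by intro j; simp [hx, mixRows]), mul_zero]

end RowExpansion

/-! ### Long cycles: detection by restricted signs, and their number -/

section LongCycles

variable {α : Type*} [Fintype α] [DecidableEq α]

open Classical in
/-- The permutations with a single orbit. -/
noncomputable def longCycles (α : Type*) [Fintype α] [DecidableEq α] : Finset (Perm α) :=
  univ.filter fun s => s.IsCycleOn Set.univ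

theorem mem_longCycles {u : Perm α} : u ∈ longCycles α ↔ ∀ x y, u.SameCycle x y := by
  simp [longCycles, Perm.IsCycleOn, Set.bijOn_univ]

theorem inv_mem_longCycles {u : Perm α} : u⁻¹ ∈ longCycles α ↔ u ∈ longCycles α := by
  simp [mem_longCycles]

theorem conj_mem_longCycles {s u : Perm α} : s * u * s⁻¹ ∈ longCycles α ↔ u ∈ longCycles α := by
  simp only [mem_longCycles, Perm.sameCycle_conj]
  refine ⟨fun h x y => ?_, fun h x y => h _ _⟩
  simpa using h (s x) (s y)

theorem exists_apply_notMem {u : Perm α} (hu : u ∈ longCycles α) {U : Finset α}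
    (hU : U.Nonempty) (hU' : U ≠ univ) : ∃ i ∈ U, u i ∉ U := by
  by_contra! h
  obtain ⟨i, hi⟩ := hU
  apply hU'
  rw [eq_univ_iff_forall]
  intro j
  obtain ⟨k, -, rfl⟩ := (mem_longCycles.1 hu i j).exists_pow_eq'
  induction k with
  | zero => simpa using hi
  | succ k ih => rw [pow_succ', Perm.mul_apply]; exact h _ ih

theorem restrictedSign_longCycle {u : Perm α} (hu : u ∈ longCycles α) {U : Finset α}
    (hU : U.Nonempty) (hU' : U ≠ univ) : restrictedSign U u = 0 := by
  obtain ⟨i, hi, h⟩ := exists_apply_notMem hu hU hU'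
  exact restrictedSign_eq_zero hi h

/-- The left side expands the principal minor of `1 - P_w` at `r`. A long cycle preserves no proper
nonempty set, which leaves `U = ∅`; otherwise the minor is singular. -/
theorem sum_rooted_restrictedSign (r : α) (w : Perm α) :
    ∑ U : Finset α, (if r ∈ U then 0 else (-1) ^ U.card * restrictedSign U w) =
      if w ∈ longCycles α then 1 else 0 := by
  split_ifs with hw
  · rw [Finset.sum_eq_single ∅]
    · simp [restrictedSign_empty]
    · intro U _ hU
      split_ifs with hr
      · rfl
      · rw [restrictedSign_longCycle hw (nonempty_iff_ne_empty.2 hU)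
          (fun h => hr (h ▸ mem_univ r)), mul_zero]
    · simp
  · set B : Matrix α α ℚ := (selfMapMatrix ℚ w).updateRow r 0 with hB
    have h1 : ((1 : Matrix α α ℚ) + (-1 : ℚ) • B).det = 0 := by
      have : ∃ j, ¬ w.SameCycle r j := by
        by_contra! h
        exact hw (mem_longCycles.2 fun x y => (h x).symm.trans (h y))
      obtain ⟨j, hj⟩ := this
      classical
      apply Matrix.exists_mulVec_eq_zero_iff.1
      -- The indicator of the points outside the cycle of `r` is `w`-invariant and zero at `r`,
      -- hence a kernel vector.
      refine ⟨fun i => if w.SameCycle r i then 0 else 1, fun h => ?_, ?_⟩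
      · simpa [hj] using congrFun h j
      · funext i
        rw [Matrix.add_mulVec, Matrix.smul_mulVec, Matrix.one_mulVec]
        by_cases hi : i = r
        · subst hi
          simp [hB, Matrix.mulVec, dotProduct, Perm.SameCycle.rfl]
        · have h2 : (B.mulVec fun i => if w.SameCycle r i then 0 else 1) i =
                if w.SameCycle r i then 0 else 1 := by
            rw [Matrix.mulVec, dotProduct, Finset.sum_eq_single (w i)]
            · simp [hB, hi, selfMapMatrix]
            · intro k _ hk
              simp [hB, hi, selfMapMatrix, hk.symm]
            · simp
          simp [h2]
    refine Eq.trans ?_ h1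
    rw [det_add_smul]
    refine Finset.sum_congr rfl fun U _ => ?_
    split_ifs with hr
    · rw [Matrix.det_eq_zero_of_row_eq_zero r, mul_zero]
      intro j; simp [mixRows, hr, hB]
    · rw [restrictedSign]
      congr 2
      ext i j
      by_cases hi : i ∈ U
      · have : i ≠ r := fun h => hr (h ▸ hi)
        simp [selfMapMatrix, restrictMap, mixRows, hB, hi, this]
      · simp [selfMapMatrix, restrictMap, mixRows, hi, Matrix.one_apply]

/-- Summing over all roots `r` removes the choice of root; a set `U` is counted once for each `r`
outside it. -/
theorem card_mul_indicator_longCycles (w : Perm α) :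
    (Fintype.card α : ℚ) * (if w ∈ longCycles α then 1 else 0) =
      ∑ U : Finset α, ((Fintype.card α : ℚ) - U.card) * (-1) ^ U.card * restrictedSign U w := by
  have h : ∑ r : α, (if w ∈ longCycles α then (1 : ℚ) else 0) =
      ∑ r : α, ∑ U : Finset α, (if r ∈ U then 0 else (-1) ^ U.card * restrictedSign U w) :=
    Finset.sum_congr rfl fun r _ => (sum_rooted_restrictedSign r w).symm
  rw [Finset.sum_const, card_univ, nsmul_eq_mul] at h
  rw [h, Finset.sum_comm]
  refine Finset.sum_congr rfl fun U _ => ?_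
  have : ∀ r, (if r ∈ U then (0 : ℚ) else (-1) ^ U.card * restrictedSign U w) =
      if r ∈ Uᶜ then (-1) ^ U.card * restrictedSign U w else 0 := by
    intro r; by_cases hr : r ∈ U <;> simp [hr]
  simp_rw [this]
  rw [← Finset.sum_filter, Finset.sum_const, filter_mem_eq_inter, univ_inter, card_compl,
    nsmul_eq_mul, Nat.cast_sub (card_le_univ U), mul_assoc]

theorem card_longCycles [Nonempty α] :
    (longCycles α).card = (Fintype.card α - 1).factorial := by
  rcases Nat.lt_or_ge (Fintype.card α) 2 with h | h
  · have h1 : Fintype.card α = 1 := le_antisymm (by omega) Fintype.card_pos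
    have := (Fintype.card_le_one_iff_subsingleton.1 h1.le)
    have : longCycles α = univ := by
      ext u; simp [mem_longCycles, Subsingleton.elim _ u,
        Subsingleton.elim (α := α) _ (Classical.arbitrary α), Perm.SameCycle.rfl]
    rw [this, card_univ, Fintype.card_perm, h1]; rfl
  · have := Perm.card_of_cycleType_singleton (α := α) h le_rfl
    rw [Nat.choose_self, mul_one] at this
    rw [← this]
    congr 1
    ext u
    rw [mem_longCycles, mem_filter]
    simp only [mem_univ, true_and]
    constructor
    · intro hu
      have : Nontrivial α := Fintype.one_lt_card_iff_nontrivial.1 h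
      have hs : ∀ x, u x ≠ x := by
        intro x hx
        obtain ⟨y, hy⟩ := exists_ne x
        exact hy (((hu x y).eq_of_left hx).symm)
      have hc : u.IsCycle := ⟨Classical.arbitrary α, hs _, fun y _ => hu _ _⟩
      rw [hc.cycleType]
      have : u.support = univ := by ext x; simp [hs]
      rw [this]; rfl
    · intro hu x y
      have hc : u.IsCycle := by
        rw [← Perm.card_cycleType_eq_one, hu]; rfl
      have hs : u.support = univ := by
        rw [← card_eq_iff_eq_univ, ← Perm.sum_cycleType, hu]; simp
      have hs' : ∀ x, u x ≠ x := fun x => Perm.mem_support.1 (hs ▸ mem_univ x)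
      exact hc.sameCycle (hs' x) (hs' y)

end LongCycles

/-! ### Generating polynomials of restricted and bordered signs -/

section SignPolynomial

open Polynomial

variable {α : Type*} [Fintype α] [DecidableEq α]

/-- The generating polynomial of the signs of the restrictions of `w`; it is `det (1 + X P_w)`. -/
noncomputable def signPoly (w : Perm α) : ℚ[X] :=
  ∑ U : Finset α, X ^ U.card * C (restrictedSign U w)

/-- The determinants obtained from `restrictedSign U w` by replacing a row in `U` by ones. -/
noncomputable def borderedSign (U : Finset α) (w : Perm α) : ℚ :=
  ∑ x ∈ U, ((selfMapMatrix ℚ (restrictMap U w)).updateRow x 1).det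

/-- The generating polynomial of `borderedSign`. -/
noncomputable def borderedPoly (w : Perm α) : ℚ[X] :=
  ∑ U : Finset α, X ^ U.card * C (borderedSign U w)

/-- The sum of the restricted signs of `w * swap x y` over the transpositions across `U`. -/
noncomputable def crossSign (U : Finset α) (w : Perm α) : ℚ :=
  ∑ x ∈ U, ∑ y ∈ Uᶜ, restrictedSign U (w * swap x y)

theorem coeff_signPoly (w : Perm α) (k : ℕ) :
    (signPoly w).coeff k = ∑ U ∈ powersetCard k univ, restrictedSign U w := by
  simp only [signPoly, finsetSum_coeff, coeff_mul_C, coeff_X_pow, powersetCard_eq_filter,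
    powerset_univ, Finset.sum_filter]
  refine Finset.sum_congr rfl fun U _ => ?_
  by_cases h : U.card = k
  · simp [h]
  · simp [h, Ne.symm h]

theorem coeff_borderedPoly (w : Perm α) (k : ℕ) :
    (borderedPoly w).coeff k = ∑ U ∈ powersetCard k univ, borderedSign U w := by
  simp only [borderedPoly, finsetSum_coeff, coeff_mul_C, coeff_X_pow, powersetCard_eq_filter,
    powerset_univ, Finset.sum_filter]
  refine Finset.sum_congr rfl fun U _ => ?_
  by_cases h : U.card = k
  · simp [h]
  · simp [h, Ne.symm h]

omit [Fintype α] in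
theorem mixRows_map_selfMapMatrix (U : Finset α) (w : Perm α) :
    mixRows U ((selfMapMatrix ℚ w).map (C : ℚ →+* ℚ[X])) 1 =
      (selfMapMatrix ℚ (restrictMap U w)).map (C : ℚ →+* ℚ[X]) := by
  ext1 i j
  by_cases hi : i ∈ U
  · simp [selfMapMatrix, restrictMap, mixRows, hi]
  · simp only [selfMapMatrix, restrictMap, mixRows, hi, if_false, Matrix.one_apply,
      Matrix.map_apply]
    split_ifs <;> simp

theorem signPoly_eq_det (w : Perm α) :
    signPoly w = (1 + (X : ℚ[X]) • (selfMapMatrix ℚ w).map (C : ℚ →+* ℚ[X])).det := by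
  rw [det_add_smul, signPoly]
  refine Finset.sum_congr rfl fun U _ => ?_
  rw [mixRows_map_selfMapMatrix, restrictedSign, RingHom.map_det]
  rfl

/-- `borderedPoly w` is `X` times the sum over `x` of the determinants of `1 + X P_w` with row `x`
replaced by ones. Each of these is `det (1 + X P_w) / (1 + X)`. -/
theorem one_add_X_mul_borderedPoly (w : Perm α) :
    (1 + X) * borderedPoly w = C (Fintype.card α : ℚ) * X * signPoly w := by
  set A : Matrix α α ℚ[X] := 1 + (X : ℚ[X]) • (selfMapMatrix ℚ w).map (C : ℚ →+* ℚ[X]) with hA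
  have h1 : borderedPoly w = ∑ x : α, X * (A.updateRow x 1).det := by
    simp_rw [hA, mul_det_updateRow_add_smul]
    rw [Finset.sum_comm, borderedPoly]
    refine Finset.sum_congr rfl fun U _ => ?_
    rw [← Finset.sum_filter, filter_mem_eq_inter, univ_inter, borderedSign, map_sum,
      Finset.mul_sum]
    refine Finset.sum_congr rfl fun x _ => ?_
    rw [mixRows_map_selfMapMatrix, RingHom.map_det]
    congr 2
    ext1 i j
    by_cases hi : i = x
    · subst hi; simp
    · simp [hi]
  -- The columns of `1 + X P_w` all sum to `1 + X`, and replacing row `x` by the sum of all rows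
  -- keeps the determinant.
  have h2 : ∀ x : α, (1 + X) * (A.updateRow x 1).det = A.det := by
    intro x
    have h := Matrix.det_updateRow_sum A x 1
    rw [Pi.one_apply, one_smul] at h
    rw [← h, ← Matrix.det_updateRow_smul]
    congr 2
    funext j
    have h3 : ∑ k : α, (selfMapMatrix ℚ w k j) = 1 := by
      rw [Finset.sum_eq_single (w.symm j)]
      · simp [selfMapMatrix]
      · intro k _ hk
        have : w k ≠ j := fun h => hk (by simp [← h])
        simp [selfMapMatrix, this]
      · simp
    simp only [hA, Pi.smul_apply, Pi.one_apply, smul_eq_mul, mul_one, Finset.sum_apply, one_mul,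
      Matrix.add_apply, Matrix.smul_apply, Matrix.map_apply, Finset.sum_add_distrib]
    rw [← Finset.mul_sum, ← map_sum, h3]
    simp [Matrix.one_apply]
  rw [h1, signPoly_eq_det, ← hA, Finset.mul_sum]
  simp_rw [mul_left_comm _ X, h2]
  rw [Finset.sum_const, card_univ, nsmul_eq_mul]
  simp [mul_assoc]

/-- The row of ones is the sum of the unit rows at `w y`. For `y ∉ U` this redirects `x` to `w y`,
as `w * swap x y` does; `y = x` returns the original matrix; any other `y ∈ U` repeats a row. -/
theorem borderedSign_eq (U : Finset α) (w : Perm α) :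
    borderedSign U w = crossSign U w + U.card * restrictedSign U w := by
  rw [borderedSign, crossSign, ← nsmul_eq_mul, ← Finset.sum_const, ← Finset.sum_add_distrib]
  refine Finset.sum_congr rfl fun x hx => ?_
  have h1 : (1 : α → ℚ) = ∑ y : α, Pi.single (w y) 1 := by
    funext j
    rw [Finset.sum_apply, Finset.sum_eq_single (w.symm j)]
    · simp
    · intro k _ hk
      have : j ≠ w k := fun h => hk (by simp [h])
      simp [this]
    · simp
  have h2 := (Matrix.detRowAlternating (n := α) (R := ℚ)).toMultilinearMap.map_update_sum
    univ x (fun y => Pi.single (w y) 1) (selfMapMatrix ℚ (restrictMap U w))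
  rw [← h1] at h2
  refine h2.trans ?_
  have h3 : ∀ y, (Matrix.detRowAlternating (n := α) (R := ℚ)).toMultilinearMap
      (Function.update (selfMapMatrix ℚ (restrictMap U w)) x (Pi.single (w y) 1)) =
      (selfMapMatrix ℚ (Function.update (restrictMap U w) x (w y))).det := by
    intro y
    change Matrix.det (Matrix.updateRow _ x _) = _
    congr 1
    ext i j
    by_cases hi : i = x
    · subst hi; simp [selfMapMatrix, Pi.single_apply, eq_comm]
    · simp [selfMapMatrix, hi]
  simp_rw [h3]
  rw [← Finset.sum_add_sum_compl U, add_comm]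
  congr 1
  · refine Finset.sum_congr rfl fun y hy => ?_
    rw [restrictedSign]
    congr 2
    funext i
    have hy' : y ∉ U := by simpa using hy
    by_cases hi : i = x
    · subst hi; simp [restrictMap, hx]
    · by_cases hU : i ∈ U
      · have : i ≠ y := fun h => hy' (h ▸ hU)
        simp [restrictMap, hU, hi, swap_apply_of_ne_of_ne hi this]
      · simp [restrictMap, hU, hi]
  · rw [Finset.sum_eq_single_of_mem x hx]
    · rw [restrictedSign]
      congr 2
      exact Function.update_eq_self_iff.2 (by simp [restrictMap, hx])
    · intro y hy hyx
      exact det_selfMapMatrix_of_eq hyx (by simp [restrictMap, hy, hyx])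

theorem sum_crossSign (w : Perm α) (k : ℕ) :
    ∑ U ∈ powersetCard k univ, crossSign U w =
      (borderedPoly w).coeff k - k * (signPoly w).coeff k := by
  rw [coeff_borderedPoly, coeff_signPoly, Finset.mul_sum, ← Finset.sum_sub_distrib]
  refine Finset.sum_congr rfl fun U hU => ?_
  rw [borderedSign_eq, (mem_powersetCard.1 hU).2]
  ring

theorem card_mul_coeff_signPoly (w : Perm α) (k : ℕ) :
    (Fintype.card α : ℚ) * (signPoly w).coeff k =
      (borderedPoly w).coeff (k + 1) + (borderedPoly w).coeff k := by
  have h := congrArg (coeff · (k + 1)) (one_add_X_mul_borderedPoly w)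
  simp only [add_mul, one_mul, coeff_add, mul_assoc, coeff_C_mul, coeff_X_mul] at h
  exact h.symm

theorem coeff_borderedPoly_zero (w : Perm α) : (borderedPoly w).coeff 0 = 0 := by
  simp [coeff_borderedPoly, borderedSign]

theorem coeff_signPoly_zero (w : Perm α) : (signPoly w).coeff 0 = 1 := by
  simp [coeff_signPoly, restrictedSign_empty]

theorem coeff_signPoly_longCycle {u : Perm α} (hu : u ∈ longCycles α) {k : ℕ}
    (hk : 0 < k) (hk' : k < Fintype.card α) : (signPoly u).coeff k = 0 := by
  rw [coeff_signPoly]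
  refine Finset.sum_eq_zero fun U hU => ?_
  have hc := (mem_powersetCard.1 hU).2
  refine restrictedSign_longCycle hu (card_pos.1 (by omega)) ?_
  rintro rfl
  rw [card_univ] at hc
  omega

/-- Strictly between degrees `0` and `n` the sign polynomial of a long cycle vanishes, so
consecutive bordered coefficients are opposite. -/
theorem coeff_borderedPoly_longCycle {u : Perm α} (hu : u ∈ longCycles α) {k : ℕ}
    (hk : k < Fintype.card α) :
    (borderedPoly u).coeff (k + 1) = (-1) ^ k * Fintype.card α := by
  induction k with
  | zero =>
    have := card_mul_coeff_signPoly u 0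
    rw [coeff_signPoly_zero, coeff_borderedPoly_zero] at this
    simpa using this.symm
  | succ k ih =>
    have := card_mul_coeff_signPoly u (k + 1)
    rw [coeff_signPoly_longCycle hu (by omega) hk, ih (by omega)] at this
    rw [pow_succ]
    linarith

end SignPolynomial

/-! ### Averaging restricted signs over long cycles -/

section LongSign

variable {α : Type*} [Fintype α] [DecidableEq α]

/-- The sum of the restricted signs of `u * w` over all long cycles `u`. -/
noncomputable def longSign (U : Finset α) (w : Perm α) : ℚ :=
  ∑ u ∈ longCycles α, restrictedSign U (u * w)

theorem longSign_mul_right {U : Finset α} {p : Perm α} (hp : ∀ i ∈ U, p i ∈ U) (w : Perm α) :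
    longSign U (w * p) = longSign U w * restrictedSign U p := by
  simp_rw [longSign, Finset.sum_mul, ← mul_assoc, restrictedSign_mul_right hp]

theorem sum_longCycles_conj (s : Perm α) (f : Perm α → ℚ) :
    ∑ u ∈ longCycles α, f (s * u * s⁻¹) = ∑ u ∈ longCycles α, f u :=
  Finset.sum_equiv (MulAut.conj s).toEquiv (fun u => by simp [conj_mem_longCycles])
    (fun u _ => by simp)

theorem longSign_mul_left {U : Finset α} {p : Perm α} (hp : ∀ i ∈ U, p i ∈ U) (w : Perm α) :
    longSign U (p * w) = restrictedSign U p * longSign U w := by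
  rw [longSign, ← sum_longCycles_conj p, longSign, Finset.mul_sum]
  refine Finset.sum_congr rfl fun u _ => ?_
  rw [← restrictedSign_mul_left hp]
  congr 1
  group

theorem longSign_of_preserves {U : Finset α} (hU : U.Nonempty) (hU' : U ≠ univ) {w : Perm α}
    (hw : ∀ i ∈ U, w i ∈ U) : longSign U w = 0 := by
  have h : longSign U 1 = 0 := by
    rw [longSign]
    refine Finset.sum_eq_zero fun u hu => ?_
    rw [mul_one, restrictedSign_longCycle hu hU hU']
  rw [← one_mul w, longSign_mul_right hw, h, zero_mul]

theorem restrictedSign_swap_sq {U : Finset α} {x y : α} (hx : x ∈ U) (hy : y ∈ U) :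
    restrictedSign U (swap x y) * restrictedSign U (swap x y) = 1 := by
  rw [← restrictedSign_mul_right (swap_preserves hx hy), swap_mul_self, restrictedSign_one]

omit [Fintype α] in
theorem swap_preserves' {U : Finset α} {x y : α} (hx : x ∉ U) (hy : y ∉ U) :
    ∀ i ∈ U, swap x y i ∈ U := by
  intro i hi
  rwa [swap_preserves_of_notMem hx hy i hi]

/-- Conjugation by `swap x x'` inside `U` costs the square of a sign; conjugation by `swap y y'`
outside `U` costs nothing. -/
theorem longSign_swap_eq {U : Finset α} {x y x' y' : α} (hx : x ∈ U) (hx' : x' ∈ U)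
    (hy : y ∉ U) (hy' : y' ∉ U) : longSign U (swap x y) = longSign U (swap x' y') := by
  have h1 : longSign U (swap x' y) = longSign U (swap x y) := by
    have h : swap x x' * swap x y * swap x x' = swap x' y := by
      have e1 : x ≠ y := ne_of_mem_of_not_mem hx hy
      have e2 : x' ≠ y := ne_of_mem_of_not_mem hx' hy
      exact Equiv.ext fun i => by
        simp only [Perm.mul_apply, swap_apply_def]
        split_ifs <;> simp_all
    rw [← h, longSign_mul_right (swap_preserves hx hx'), longSign_mul_left (swap_preserves hx hx'),
      mul_right_comm, restrictedSign_swap_sq hx hx', one_mul]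
  have h2 : longSign U (swap x' y') = longSign U (swap x' y) := by
    have h : swap y y' * swap x' y * swap y y' = swap x' y' := by
      have e1 : x' ≠ y := fun h => hy (h ▸ hx')
      have e2 : x' ≠ y' := fun h => hy' (h ▸ hx')
      exact Equiv.ext fun i => by
        simp only [Perm.mul_apply, swap_apply_def]
        split_ifs <;> simp_all
    have e := restrictedSign_eq_one (swap_preserves_of_notMem hy hy')
    rw [← h, longSign_mul_right (swap_preserves' hy hy'), longSign_mul_left (swap_preserves' hy hy'),
      e, one_mul, mul_one]
  rw [h2, h1]

theorem crossSign_of_preserves {U : Finset α} {w : Perm α} (hw : ∀ i ∈ U, w i ∈ U) :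
    crossSign U w = 0 := by
  refine Finset.sum_eq_zero fun x hx => Finset.sum_eq_zero fun y hy => ?_
  refine restrictedSign_eq_zero hx ?_
  simpa [preserves_iff hw] using hy

theorem exists_notMem_apply_mem {U : Finset α} {w : Perm α} {x : α} (hx : x ∈ U)
    (hwx : w x ∉ U) : ∃ y, y ∉ U ∧ w y ∈ U := by
  by_contra! h
  have := preserves_iff (U := Uᶜ) (p := w) (by simpa using h) x
  simp [hx, hwx] at this

/-- The argument splits by how many points of `U` leave `U` under `w`. With none, both sides vanish.
With two or more, both vanish again. With exactly one, `w` is a permutation preserving `U` times a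
transposition across `U`, and equivariance reduces to that transposition. -/
theorem longSign_eq_mul_crossSign {U : Finset α} {x₀ y₀ : α} (hx₀ : x₀ ∈ U) (hy₀ : y₀ ∉ U)
    (w : Perm α) : longSign U w = longSign U (swap x₀ y₀) * crossSign U w := by
  by_cases hw : ∀ i ∈ U, w i ∈ U
  · rw [crossSign_of_preserves hw, mul_zero]
    exact longSign_of_preserves ⟨_, hx₀⟩ (fun h => hy₀ (h ▸ mem_univ _)) hw
  push Not at hw
  obtain ⟨x, hx, hwx⟩ := hw
  by_cases h2 : ∃ x' ∈ U, x' ≠ x ∧ w x' ∉ U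
  · obtain ⟨x', hx', hne, hwx'⟩ := h2
    have hB : longSign U w = 0 := by
      -- The same permutation arises from a transposition inside `U` on the right, which changes the
      -- sign, and from one outside `U` on the left, which does not.
      have h3 : w * swap x x' = swap (w x) (w x') * w := by
        rw [mul_swap_eq_swap_mul]
      have h4 : longSign U (w * swap x x') = - longSign U w := by
        rw [longSign_mul_right (swap_preserves hx hx'), restrictedSign_swap hx hx' hne.symm]
        ring
      have h5 : longSign U (w * swap x x') = longSign U w := by
        rw [h3, longSign_mul_left (swap_preserves' hwx hwx'),
          restrictedSign_eq_one (swap_preserves_of_notMem hwx hwx'), one_mul]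
      linarith
    rw [hB, crossSign, Finset.sum_eq_zero, mul_zero]
    intro z hz
    refine Finset.sum_eq_zero fun y hy => ?_
    have hy : y ∉ U := by simpa using hy
    by_cases hzx : z = x
    · subst hzx
      refine restrictedSign_eq_zero hx' ?_
      rwa [Perm.mul_apply, swap_apply_of_ne_of_ne hne (ne_of_mem_of_not_mem hx' hy)]
    · refine restrictedSign_eq_zero hx ?_
      rwa [Perm.mul_apply, swap_apply_of_ne_of_ne (Ne.symm hzx) (ne_of_mem_of_not_mem hx hy)]
  · push Not at h2
    obtain ⟨y, hy, hwy⟩ := exists_notMem_apply_mem hx hwx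
    have hh : ∀ i ∈ U, (w * swap x y) i ∈ U := by
      intro i hi
      by_cases hix : i = x
      · subst hix; simpa using hwy
      · rw [Perm.mul_apply, swap_apply_of_ne_of_ne hix (ne_of_mem_of_not_mem hi hy)]
        exact h2 i hi hix
    have h3 : crossSign U w = restrictedSign U (w * swap x y) := by
      rw [crossSign, Finset.sum_eq_single_of_mem x hx,
        Finset.sum_eq_single_of_mem y (by simpa using hy)]
      · intro z hz hzy
        have hz : z ∉ U := by simpa using hz
        refine restrictedSign_eq_zero hx ?_
        rw [Perm.mul_apply, swap_apply_left]
        have := (preserves_iff hh z).not.2 hz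
        rwa [Perm.mul_apply, swap_apply_of_ne_of_ne (ne_of_mem_of_not_mem hx hz).symm hzy] at this
      · intro z hz hzx
        refine Finset.sum_eq_zero fun y' hy' => ?_
        have hy' : y' ∉ U := by simpa using hy'
        refine restrictedSign_eq_zero hx ?_
        rwa [Perm.mul_apply, swap_apply_of_ne_of_ne (Ne.symm hzx) (ne_of_mem_of_not_mem hx hy')]
    have h4 : w = w * swap x y * swap x y := by simp [mul_assoc]
    rw [h3, longSign_swap_eq hx₀ hx hy₀ hy]
    conv_lhs => rw [h4]
    rw [longSign_mul_left hh, mul_comm]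

theorem sum_longCycles_crossSign_map (s : Perm α) (U : Finset α) :
    ∑ u ∈ longCycles α, crossSign (U.map s.toEmbedding) u =
      ∑ u ∈ longCycles α, crossSign U u := by
  rw [← sum_longCycles_conj s]
  refine Finset.sum_congr rfl fun u _ => ?_
  rw [crossSign, crossSign, Finset.sum_map]
  refine Finset.sum_congr rfl fun x _ => ?_
  have : (U.map s.toEmbedding)ᶜ = Uᶜ.map s.toEmbedding := by
    ext i; simp only [mem_compl, Finset.mem_map_equiv]
  rw [this, Finset.sum_map]
  refine Finset.sum_congr rfl fun y _ => ?_
  rw [← restrictedSign_conj U s]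
  congr 1
  have : swap (s x) (s y) = s * swap x y * s⁻¹ := by
    rw [mul_swap_eq_swap_mul]; group
  simp only [Equiv.coe_toEmbedding, this]
  group

theorem sum_longCycles_crossSign_eq {U V : Finset α} (h : U.card = V.card) :
    ∑ u ∈ longCycles α, crossSign U u = ∑ u ∈ longCycles α, crossSign V u := by
  have e : U ≃ V := Finset.equivOfCardEq h
  have : V = U.map e.extendSubtype.toEmbedding := by
    refine (Finset.eq_of_subset_of_card_le ?_ (by simp [h])).symm
    intro i hi
    obtain ⟨j, hj, rfl⟩ := mem_map.1 hi
    exact e.extendSubtype_mem j hj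
  rw [this, sum_longCycles_crossSign_map]

/-- By conjugation the sum depends only on the size of `U`, so it can be averaged over all sets of
that size, where the coefficients for long cycles are known. -/
theorem choose_mul_sum_crossSign {U : Finset α} {k : ℕ} (hU : U.card = k + 1)
    (hk : k + 1 < Fintype.card α) :
    ((Fintype.card α).choose (k + 1) : ℚ) * ∑ u ∈ longCycles α, crossSign U u =
      (-1) ^ k * (Fintype.card α).factorial := by
  have h1 : ∑ V ∈ powersetCard (k + 1) (univ : Finset α), ∑ u ∈ longCycles α, crossSign V u =
      ((Fintype.card α).choose (k + 1) : ℚ) * ∑ u ∈ longCycles α, crossSign U u := by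
    rw [Finset.sum_congr rfl fun V hV =>
      sum_longCycles_crossSign_eq ((mem_powersetCard.1 hV).2.trans hU.symm), Finset.sum_const,
      card_powersetCard, card_univ, nsmul_eq_mul]
  have : Nonempty α := Fintype.card_pos_iff.1 (by omega)
  rw [← h1, Finset.sum_comm]
  simp_rw [sum_crossSign]
  rw [Finset.sum_congr rfl fun u hu => by
    rw [coeff_borderedPoly_longCycle hu (by omega), coeff_signPoly_longCycle hu (by omega) hk,
      mul_zero, sub_zero], Finset.sum_const, card_longCycles, nsmul_eq_mul]
  obtain ⟨d, hd⟩ : ∃ d, Fintype.card α = d + 1 := ⟨Fintype.card α - 1, by omega⟩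
  rw [hd, Nat.add_sub_cancel, Nat.factorial_succ]
  push_cast
  ring

theorem longSign_eq {U : Finset α} {k l : ℕ} (hU : U.card = k + 1)
    (hl : Fintype.card α = k + 1 + (l + 1)) (w : Perm α) :
    longSign U w = (-1) ^ k * k.factorial * l.factorial * crossSign U w := by
  have hc : Uᶜ.card = l + 1 := by rw [card_compl]; omega
  obtain ⟨x₀, hx₀⟩ : U.Nonempty := card_pos.1 (by omega)
  obtain ⟨y₀, hy₀⟩ : Uᶜ.Nonempty := card_pos.1 (by omega)
  have hy₀ : y₀ ∉ U := by simpa using hy₀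
  rw [longSign_eq_mul_crossSign hx₀ hy₀]
  congr 1
  -- Summing `crossSign U` over the long cycles gives one equal value of `longSign` per
  -- transposition across `U`, which fixes the constant.
  have h1 : ∑ u ∈ longCycles α, crossSign U u =
      ((k + 1 : ℕ) : ℚ) * ((l + 1 : ℕ) * longSign U (swap x₀ y₀)) := by
    simp_rw [crossSign]
    rw [Finset.sum_comm, ← hU, ← nsmul_eq_mul, ← Finset.sum_const]
    refine Finset.sum_congr rfl fun x hx => ?_
    rw [Finset.sum_comm, ← hc, ← nsmul_eq_mul, ← Finset.sum_const]
    refine Finset.sum_congr rfl fun y hy => ?_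
    rw [← longSign_swap_eq hx hx₀ (by simpa using hy) hy₀, longSign]
  have h2 := choose_mul_sum_crossSign hU (by omega)
  have h3 := Nat.add_choose_mul_factorial_mul_factorial (k + 1) (l + 1)
  rw [← hl, ← Nat.choose_symm_of_eq_add hl] at h3
  rw [h1, ← h3, Nat.factorial_succ, Nat.factorial_succ] at h2
  have h4 : ((Fintype.card α).choose (k + 1) : ℚ) ≠ 0 := by
    exact_mod_cast (Nat.choose_pos (by omega)).ne'
  push_cast at h2
  have h5 : (k : ℚ) + 1 ≠ 0 := by positivity
  have h6 : (l : ℚ) + 1 ≠ 0 := by positivity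
  refine mul_left_cancel₀ h4 (mul_left_cancel₀ h5 (mul_left_cancel₀ h6 ?_))
  linear_combination h2

theorem longSign_empty (w : Perm α) : longSign ∅ w = (longCycles α).card := by
  simp [longSign, restrictedSign_empty]

/-- The number of long cycles `u` with `u * w` a long cycle, in terms of `borderedPoly w`. -/
theorem card_sq_mul_sum_indicator {d : ℕ} (hd : Fintype.card α = d + 1) (w : Perm α) :
    ((d : ℚ) + 1) ^ 2 * ∑ u ∈ longCycles α, (if u * w ∈ longCycles α then 1 else 0) =
      ∑ k ∈ range (d + 1), (k.factorial * (d - k).factorial : ℚ) *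
        (borderedPoly w).coeff (k + 1) := by
  have : Nonempty α := Fintype.card_pos_iff.1 (by omega)
  have h1 : ((d : ℚ) + 1) * ∑ u ∈ longCycles α, (if u * w ∈ longCycles α then 1 else 0) =
      ∑ U ∈ (univ : Finset α).powerset,
        ((d : ℚ) + 1 - U.card) * (-1) ^ U.card * longSign U w := by
    simp_rw [longSign, Finset.mul_sum]
    rw [powerset_univ, Finset.sum_comm]
    refine Finset.sum_congr rfl fun u _ => ?_
    have := card_mul_indicator_longCycles (u * w)
    rw [hd] at this
    push_cast at this
    exact this
  rw [Finset.sum_powerset, card_univ, hd, Finset.sum_range_succ, Finset.sum_range_succ'] at h1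
  have h2 : ∀ k ∈ range d, ((d : ℚ) + 1) * ∑ U ∈ powersetCard (k + 1) (univ : Finset α),
      ((d : ℚ) + 1 - U.card) * (-1) ^ U.card * longSign U w =
      ((k + 1).factorial * (d - k).factorial : ℚ) * (borderedPoly w).coeff (k + 2) -
      (k.factorial * (d - k).factorial * (d - k) : ℚ) * (borderedPoly w).coeff (k + 1) := by
    intro k hk
    obtain ⟨l, rfl⟩ : ∃ l, d = k + 1 + l := ⟨d - (k + 1), by have := mem_range.1 hk; omega⟩
    have hl : k + 1 + l - k = l + 1 := by omega
    have h3 : ∑ U ∈ powersetCard (k + 1) (univ : Finset α),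
        (((k + 1 + l : ℕ) : ℚ) + 1 - U.card) * (-1) ^ U.card * longSign U w =
        - ((l + 1) * k.factorial * l.factorial) *
          ∑ U ∈ powersetCard (k + 1) (univ : Finset α), crossSign U w := by
      rw [Finset.mul_sum]
      refine Finset.sum_congr rfl fun U hU => ?_
      have hU := (mem_powersetCard.1 hU).2
      rw [longSign_eq hU (by omega : Fintype.card α = k + 1 + (l + 1)), hU]
      have : ((-1 : ℚ) ^ k) * (-1) ^ k = 1 := by rw [← mul_pow]; simp
      push_cast
      rw [pow_succ]
      linear_combination (-(l + 1 : ℚ) * k.factorial * l.factorial * crossSign U w) * this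
    have h4 := card_mul_coeff_signPoly w (k + 1)
    rw [hd] at h4
    rw [h3, sum_crossSign, hl, Nat.factorial_succ, Nat.factorial_succ]
    push_cast at h4 ⊢
    linear_combination ((l + 1 : ℚ) * k.factorial * l.factorial * (k + 1)) * h4
  have h5 : (borderedPoly w).coeff 1 = d + 1 := by
    have := card_mul_coeff_signPoly w 0
    rw [coeff_signPoly_zero, coeff_borderedPoly_zero, hd] at this
    push_cast at this
    linarith
  -- The full set has weight `n - |U| = 0`, so `longSign` is never needed there.
  have h6 : ∑ U ∈ powersetCard (d + 1) (univ : Finset α),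
      ((d : ℚ) + 1 - U.card) * (-1) ^ U.card * longSign U w = 0 := by
    refine Finset.sum_eq_zero fun U hU => ?_
    rw [(mem_powersetCard.1 hU).2]
    push_cast
    ring
  rw [h6, powersetCard_zero, Finset.sum_singleton, longSign_empty, card_longCycles, hd] at h1
  rw [pow_two, mul_assoc, h1, mul_add, mul_add, Finset.mul_sum, Finset.sum_congr rfl h2,
    Finset.sum_sub_distrib]
  -- After an index shift the two sums nearly cancel, by `(d + 1 - k)! - (d - k) (d - k)! = (d -
  -- k)!`; the term of `U = ∅` supplies the missing index `0`.
  have h7 := Finset.sum_range_succ' (fun k => (k.factorial * (d + 1 - k).factorial : ℚ) *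
        (borderedPoly w).coeff (k + 1)) d
  simp only [Nat.add_sub_add_right, zero_add] at h7
  rw [Finset.sum_range_succ] at h7
  rw [Finset.sum_range_succ]
  have h8 : ∑ k ∈ range d, (k.factorial * (d + 1 - k).factorial : ℚ) *
        (borderedPoly w).coeff (k + 1) -
      ∑ k ∈ range d, (k.factorial * (d - k).factorial * (d - k) : ℚ) *
        (borderedPoly w).coeff (k + 1) = ∑ k ∈ range d, (k.factorial * (d - k).factorial : ℚ) *
        (borderedPoly w).coeff (k + 1) := by
    rw [← Finset.sum_sub_distrib]
    refine Finset.sum_congr rfl fun k hk => ?_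
    have hk := (mem_range.1 hk).le
    rw [Nat.succ_sub hk, Nat.factorial_succ]
    push_cast [hk]
    ring
  rw [← h8]
  simp only [Nat.add_sub_cancel_left, Nat.add_sub_cancel, Nat.sub_self, Nat.sub_zero, h5,
    Nat.factorial_zero, Nat.factorial_succ, card_empty, pow_zero] at h7 ⊢
  push_cast at h7 ⊢
  linear_combination -h7

end LongSign

/-! ### Sign polynomial summed over separating permutations -/

section Separation

variable {α : Type*} [Fintype α] [DecidableEq α]

omit [DecidableEq α] in
theorem sameCycle_map {v w : Perm α} {f : α → α} (h : ∀ x, w.SameCycle (f x) (f (v x)))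
    {x y : α} (hxy : v.SameCycle x y) : w.SameCycle (f x) (f y) := by
  obtain ⟨k, -, rfl⟩ := hxy.exists_pow_eq'
  induction k with
  | zero => exact Perm.SameCycle.rfl
  | succ k ih =>
    rw [pow_succ', Perm.mul_apply]
    exact (ih ⟨k, by simp⟩).trans (h _)

theorem sameCycle_swap_mul_iff {w : Perm α} {z : α} (hz : w z = z) (i : α) {x y : α}
    (hx : x ≠ z) (hy : y ≠ z) : (swap z i * w).SameCycle x y ↔ w.SameCycle x y := by
  have hw : ∀ t, t ≠ z → w t ≠ z := fun t ht h => ht (w.injective (h.trans hz.symm))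
  constructor
  · intro h
    -- Collapsing `z` onto `i` turns each step of `swap z i * w` into a step of `w` or a stationary
    -- one.
    have := sameCycle_map (w := w) (f := fun t => if t = z then i else t) (fun t => ?_) h
    · simpa [hx, hy] using this
    · by_cases ht : t = z
      · subst ht
        by_cases hi : i = t <;> simp [hz, hi, Perm.SameCycle.rfl]
      · by_cases hi : w t = i
        · subst hi
          simp [ht, Perm.sameCycle_apply_right, Perm.SameCycle.rfl]
        · simp [ht, swap_apply_of_ne_of_ne (hw t ht) hi, hw t ht, Perm.sameCycle_apply_right,
            Perm.SameCycle.rfl]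
  · refine sameCycle_map (f := id) fun t => ?_
    by_cases ht : t = z
    · subst ht; simp [hz, Perm.SameCycle.rfl]
    · by_cases hi : w t = i
      -- The new cycle makes the detour `t ↦ z ↦ i`.
      · refine ⟨2, ?_⟩
        subst hi
        rw [zpow_ofNat, pow_two]
        simp [hz]
      · refine ⟨1, ?_⟩
        simp [swap_apply_of_ne_of_ne (hw t ht) hi]

open Classical in
/-- The permutations supported in `W` for which the elements of `A` lie in distinct cycles. -/
noncomputable def separating (A W : Finset α) : Finset (Perm α) :=
  univ.filter fun w => (∀ i ∉ W, w i = i) ∧ ∀ i ∈ A, ∀ j ∈ A, i ≠ j → ¬ w.SameCycle i j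

theorem mem_separating {A W : Finset α} {w : Perm α} : w ∈ separating A W ↔
    (∀ i ∉ W, w i = i) ∧ ∀ i ∈ A, ∀ j ∈ A, i ≠ j → ¬ w.SameCycle i j := by
  simp [separating]

theorem separating_self (A : Finset α) : separating A A = {1} := by
  ext w
  rw [mem_separating, mem_singleton]
  constructor
  · rintro ⟨h1, h2⟩
    ext i
    by_contra hi
    have hiA : i ∈ A := by
      by_contra h; exact hi (h1 i h)
    have hwi : w i ∈ A := by
      by_contra h; exact hi (w.injective (h1 _ h))
    exact h2 i hiA _ hwi (Ne.symm hi) (by simp [Perm.sameCycle_apply_right, Perm.SameCycle.rfl])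
  · rintro rfl
    exact ⟨fun _ _ => rfl, fun i _ j _ h => by simpa using h⟩

theorem swap_mul_mem_separating {A W : Finset α} {z : α} (hz : z ∉ W) (hA : A ⊆ W) {w : Perm α}
    (hwz : w z = z) {i : α} (hi : i ∈ insert z W) :
    swap z i * w ∈ separating A (insert z W) ↔ w ∈ separating A W := by
  have hne : ∀ j ∈ A, j ≠ z := fun j hj h => hz (h ▸ hA hj)
  rw [mem_separating, mem_separating]
  refine and_congr ⟨fun h j hj => ?_, fun h j hj => ?_⟩ ?_
  · by_cases hjz : j = z
    · rw [hjz, hwz]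
    · have hj' : j ∉ insert z W := by simp [hjz, hj]
      have h1 := h j hj'
      simpa [swap_apply_of_ne_of_ne hjz (ne_of_mem_of_not_mem hi hj').symm] using
        congrArg (swap z i) h1
  · have h1 : j ∉ W := fun h => hj (mem_insert_of_mem h)
    rw [Perm.mul_apply, h j h1, swap_apply_of_ne_of_ne
      (ne_of_mem_of_not_mem (mem_insert_self z W) hj).symm
      (ne_of_mem_of_not_mem hi hj).symm]
  · refine forall₂_congr fun x hx => forall₂_congr fun y hy => ?_
    rw [sameCycle_swap_mul_iff hwz i (hne x hx) (hne y hy)]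

/-- Each permutation of `insert z W` arises uniquely by inserting `z` into a cycle of a permutation
of `W` or leaving it fixed. As `z ∉ A`, separation of `A` is unaffected. -/
theorem sum_separating_insert {A W : Finset α} {z : α} (hz : z ∉ W) (hA : A ⊆ W)
    (f : Perm α → ℚ) : ∑ w ∈ separating A (insert z W), f w =
      ∑ w ∈ separating A W, ∑ i ∈ insert z W, f (swap z i * w) := by
  rw [← Finset.sum_product']
  symm
  refine Finset.sum_bij' (fun p _ => swap z p.2 * p.1) (fun w _ => (swap z (w z) * w, w z))
    ?_ ?_ ?_ ?_ ?_
  · rintro ⟨w, i⟩ h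
    rw [mem_product] at h
    exact (swap_mul_mem_separating hz hA ((mem_separating.1 h.1).1 z hz) h.2).2 h.1
  · intro w h
    have hwz : w z ∈ insert z W := by
      by_contra h1
      exact h1 (by rw [w.injective ((mem_separating.1 h).1 _ h1)]; exact mem_insert_self _ _)
    rw [mem_product]
    refine ⟨(swap_mul_mem_separating hz hA (by simp) hwz).1 ?_, hwz⟩
    rwa [swap_mul_self_mul]
  · rintro ⟨w, i⟩ h
    have := (mem_separating.1 (mem_product.1 h).1).1 z hz
    simp [this]
  · intro w _
    simp
  · intros; rfl

/-- The sum of the restricted signs over the permutations supported in `W` separating `A`. -/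
noncomputable def separatingSign (A W U : Finset α) : ℚ :=
  ∑ w ∈ separating A W, restrictedSign U w

/-- Inserting `z` with `i ∉ U` does not change the sign on `U`; with `i ∈ U` the set is no longer
preserved. -/
theorem separatingSign_insert {A W U : Finset α} {z : α} (hz : z ∉ W) (hA : A ⊆ W)
    (hU : U ⊆ W) :
    separatingSign A (insert z W) U = (W.card + 1 - U.card) * separatingSign A W U := by
  have hzU : z ∉ U := fun h => hz (hU h)
  rw [separatingSign, sum_separating_insert hz hA, separatingSign, Finset.mul_sum]
  refine Finset.sum_congr rfl fun w hw => ?_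
  have h : ∀ i ∈ insert z W, restrictedSign U (swap z i * w) =
      if i ∉ U then restrictedSign U w else 0 := by
    intro i _
    by_cases hi : i ∉ U
    · rw [if_pos hi, restrictedSign_mul_left (swap_preserves' hzU hi),
        restrictedSign_eq_one (swap_preserves_of_notMem hzU hi), one_mul]
    · rw [if_neg hi]
      push Not at hi
      by_contra h0
      have hp : ∀ j ∈ U, (swap z i * w) j ∈ U := by
        intro j hj
        by_contra h1
        exact h0 (restrictedSign_eq_zero hj h1)
      have := (preserves_iff hp z).not.2 hzU
      rw [Perm.mul_apply, (mem_separating.1 hw).1 z hz, swap_apply_left] at this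
      exact this hi
  rw [Finset.sum_congr rfl h, ← Finset.sum_filter, Finset.sum_const, nsmul_eq_mul,
    filter_notMem_eq_sdiff, card_sdiff_of_subset (hU.trans (subset_insert z W)),
    Nat.cast_sub (card_le_card (hU.trans (subset_insert z W))), card_insert_of_notMem hz]
  push_cast
  rfl

/-- The choice `i = z` contributes `1`, each `i ∈ U` contributes `-1`, and every other `i` sends `z`
out of the set. -/
theorem separatingSign_insert_insert {A W U : Finset α} {z : α} (hz : z ∉ W) (hA : A ⊆ W)
    (hU : U ⊆ W) :
    separatingSign A (insert z W) (insert z U) = (1 - U.card) * separatingSign A W U := by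
  have hzU : z ∉ U := fun h => hz (hU h)
  rw [separatingSign, sum_separating_insert hz hA, separatingSign, Finset.mul_sum]
  refine Finset.sum_congr rfl fun w hw => ?_
  have hwz := (mem_separating.1 hw).1 z hz
  have h : ∀ i ∈ W, restrictedSign (insert z U) (swap z i * w) =
      if i ∈ U then - restrictedSign U w else 0 := by
    intro i hiW
    have hiz : i ≠ z := fun h => hz (h ▸ hiW)
    split_ifs with hi
    · rw [restrictedSign_mul_left
        (swap_preserves (mem_insert_self z U) (mem_insert_of_mem hi)),
        restrictedSign_swap (mem_insert_self z U) (mem_insert_of_mem hi) hiz.symm,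
        restrictedSign_insert hwz, neg_one_mul]
    · refine restrictedSign_eq_zero (mem_insert_self z U) ?_
      simp [hwz, hiz, hi]
  rw [Finset.sum_insert hz, Finset.sum_congr rfl h, ← Finset.sum_filter, Finset.sum_const,
    filter_mem_eq_inter, inter_eq_right.2 hU, swap_self, nsmul_eq_mul]
  change restrictedSign (insert z U) (1 * w) + _ = _
  rw [one_mul, restrictedSign_insert hwz]
  ring

open Polynomial

/-- The generating polynomial of `separatingSign A W`. -/
noncomputable def separatingPoly (A W : Finset α) : ℚ[X] :=
  ∑ U ∈ W.powerset, X ^ U.card * C (separatingSign A W U)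

theorem separatingPoly_self (A : Finset α) : separatingPoly A A = (1 + X) ^ A.card := by
  have h := Finset.sum_pow_mul_eq_add_pow (X : ℚ[X]) 1 A
  rw [add_comm, ← h]
  refine Finset.sum_congr rfl fun U _ => ?_
  simp [separatingSign, separating_self, restrictedSign_one]

theorem separatingPoly_insert {A W : Finset α} {z : α} (hz : z ∉ W) (hA : A ⊆ W) :
    separatingPoly A (insert z W) = (C (W.card + 1 : ℚ) + X) * separatingPoly A W -
      X * (1 + X) * derivative (separatingPoly A W) := by
  rw [separatingPoly, Finset.sum_powerset_insert hz, separatingPoly, derivative_sum,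
    Finset.mul_sum, Finset.mul_sum, ← Finset.sum_add_distrib, ← Finset.sum_sub_distrib]
  refine Finset.sum_congr rfl fun U hU => ?_
  have hU := mem_powerset.1 hU
  rw [separatingSign_insert hz hA hU, separatingSign_insert_insert hz hA hU,
    card_insert_of_notMem (fun h => hz (hU h))]
  have h1 : (X : ℚ[X]) * derivative (X ^ U.card * C (separatingSign A W U)) =
      C (U.card : ℚ) * X ^ U.card * C (separatingSign A W U) := by
    rcases Nat.eq_zero_or_pos U.card with h | h
    · simp [h]
    · obtain ⟨k, hk⟩ : ∃ k, U.card = k + 1 := ⟨U.card - 1, by omega⟩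
      simp [hk]
      ring
  rw [mul_comm X (1 + X), mul_assoc (1 + X), h1]
  simp only [map_mul, map_sub, map_add, map_one, pow_succ]
  ring

theorem separatingPoly_univ (A : Finset α) :
    separatingPoly A univ = ∑ w ∈ separating A univ, signPoly w := by
  simp_rw [separatingPoly, separatingSign, signPoly, map_sum, Finset.mul_sum, powerset_univ]
  rw [Finset.sum_comm]

/-- The cofactor of `(1 + X) ^ m` in `separatingPoly`. -/
noncomputable def separatingCofactor (m : ℕ) : ℕ → ℚ[X]
  | 0 => 1
  | N + 1 => (C (m + N + 1 : ℚ) + C (1 - m : ℚ) * X) * separatingCofactor m N -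
      X * (1 + X) * derivative (separatingCofactor m N)

/-- The recursion preserves the factor `(1 + X) ^ m`, because `X (1 + X)` times its derivative is `m
X (1 + X) ^ m`. This changes the coefficient of `X` from `1` to `1 - m`. -/
theorem separatingPoly_union (A : Finset α) (T : Finset α) (h : Disjoint A T) :
    separatingPoly A (A ∪ T) = (1 + X) ^ A.card * separatingCofactor A.card T.card := by
  induction T using Finset.induction_on with
  | empty => simp [separatingPoly_self, separatingCofactor]
  | insert z T hz ih =>
    rw [disjoint_insert_right] at h
    have hz' : z ∉ A ∪ T := by simp [h.1, hz]
    rw [union_insert, separatingPoly_insert hz' subset_union_left, ih h.2,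
      card_insert_of_notMem hz, card_union_of_disjoint h.2, separatingCofactor]
    have h1 : (1 + X) * derivative ((1 + X : ℚ[X]) ^ A.card) =
        C (A.card : ℚ) * (1 + X) ^ A.card := by
      rcases Nat.eq_zero_or_pos A.card with h | h
      · simp [h]
      · obtain ⟨k, hk⟩ : ∃ k, A.card = k + 1 := ⟨A.card - 1, by omega⟩
        simp [hk, derivative_pow]
        ring
    rw [derivative_mul]
    simp only [map_sub, map_add, map_one, Nat.cast_add]
    linear_combination (-X * separatingCofactor A.card T.card) * h1

theorem sum_signPoly_separating (A : Finset α) :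
    ∑ w ∈ separating A univ, signPoly w =
      (1 + X) ^ A.card * separatingCofactor A.card (Fintype.card α - A.card) := by
  rw [← separatingPoly_univ, ← union_compl A, separatingPoly_union A Aᶜ disjoint_compl_right,
    card_compl]

theorem coeff_separatingCofactor (m N i : ℕ) :
    (separatingCofactor (m + 1) N).coeff i =
      (-1) ^ i * N.choose i * m.ascFactorial i * (m + 2).ascFactorial (N - i) := by
  induction N generalizing i with
  | zero =>
    cases i with
    | zero => simp [separatingCofactor]
    | succ i => simp [separatingCofactor, coeff_one]
  | succ N ih =>
    rw [separatingCofactor, add_mul, mul_assoc, mul_assoc, add_mul, one_mul, mul_add]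
    cases i with
    | zero =>
      simp [ih, mul_coeff_zero, Nat.ascFactorial_succ]
      left
      ring
    | succ i =>
      simp only [coeff_sub, coeff_add, coeff_C_mul, coeff_X_mul, ih]
      have hX : (X * derivative (separatingCofactor (m + 1) N)).coeff i =
          i * (separatingCofactor (m + 1) N).coeff i := by
        cases i with
        | zero => simp
        | succ i => rw [coeff_X_mul, coeff_derivative]; push_cast; ring
      rw [hX, ih, coeff_derivative, ih, Nat.choose_succ_succ', Nat.ascFactorial_succ,
        Nat.add_sub_add_right]
      push_cast
      rcases lt_or_ge i N with hi | hi
      · obtain ⟨l, rfl⟩ : ∃ l, N = i + 1 + l := ⟨N - (i + 1), by omega⟩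
        have e1 : i + 1 + l - i = l + 1 := by omega
        rw [e1, Nat.add_sub_cancel_left, Nat.ascFactorial_succ]
        push_cast
        ring
      · rw [Nat.choose_eq_zero_of_lt (by omega : N < i + 1), Nat.sub_eq_zero_of_le hi]
        push_cast
        ring

end Separation

/-! ### The Beta functional and a telescoping sum -/

section BetaSum

open Polynomial

/-- The linear functional with `X ^ k ↦ k! (d - k)!`, a multiple of `p ↦ ∫ p(t/(1-t)) (1-t)^d`. -/
noncomputable def betaSum (d : ℕ) (p : ℚ[X]) : ℚ :=
  ∑ k ∈ range (d + 1), (k.factorial * (d - k).factorial : ℚ) * p.coeff k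

theorem betaSum_one_add_X_mul {d : ℕ} {p : ℚ[X]} (hp : p.natDegree ≤ d) :
    betaSum (d + 1) ((1 + X) * p) = (d + 2) * betaSum d p := by
  have h1 : betaSum (d + 1) p = ∑ k ∈ range (d + 1),
      (k.factorial * (d + 1 - k).factorial : ℚ) * p.coeff k := by
    rw [betaSum, Finset.sum_range_succ, coeff_eq_zero_of_natDegree_lt (by omega), mul_zero,
      add_zero]
  have h2 : betaSum (d + 1) (X * p) = ∑ k ∈ range (d + 1),
      ((k + 1).factorial * (d - k).factorial : ℚ) * p.coeff k := by
    rw [betaSum, Finset.sum_range_succ', coeff_X_mul_zero, mul_zero, add_zero]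
    simp only [coeff_X_mul, Nat.add_sub_add_right]
  have h3 : betaSum (d + 1) ((1 + X) * p) = betaSum (d + 1) p + betaSum (d + 1) (X * p) := by
    simp only [betaSum, add_mul, one_mul, coeff_add, mul_add, Finset.sum_add_distrib]
  rw [h3, h1, h2, betaSum, Finset.mul_sum, ← Finset.sum_add_distrib]
  refine Finset.sum_congr rfl fun k hk => ?_
  have hk : k ≤ d := by have := mem_range.1 hk; omega
  rw [Nat.succ_sub hk, Nat.factorial_succ, Nat.factorial_succ]
  push_cast [hk]
  ring

/-- With `X = t / (1 - t)` one has `1 + X = 1 / (1 - t)`, so the factor `(1 + X) ^ m` cancels `m`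
powers of `1 - t` in the integral; the factorials are the normalizations. -/
theorem factorial_mul_betaSum {N : ℕ} {p : ℚ[X]} (hp : p.natDegree ≤ N) (m : ℕ) :
    ((N + 1).factorial : ℚ) * betaSum (N + m) ((1 + X) ^ m * p) =
      (N + m + 1).factorial * betaSum N p := by
  induction m with
  | zero => simp
  | succ m ih =>
    have hd : ((1 + X : ℚ[X]) ^ m * p).natDegree ≤ N + m := by
      have h1 : (1 + X : ℚ[X]).natDegree ≤ 1 := by compute_degree
      have h2 : ((1 + X : ℚ[X]) ^ m).natDegree ≤ m := natDegree_pow_le_of_le m h1 |>.trans (by simp)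
      exact natDegree_mul_le.trans (by omega)
    rw [pow_succ', mul_assoc, ← add_assoc, betaSum_one_add_X_mul hd, mul_left_comm, ih,
      Nat.factorial_succ (N + m + 1)]
    push_cast
    ring

theorem natDegree_separatingCofactor (m N : ℕ) :
    (separatingCofactor (m + 1) N).natDegree ≤ N := by
  rw [natDegree_le_iff_coeff_eq_zero]
  intro i hi
  rw [coeff_separatingCofactor, Nat.choose_eq_zero_of_lt hi]
  simp

/-- The weights cancel the binomial coefficients. Splitting `2m + 2 + N = (m + i) + (m + 2 + N - i)`
extends one or the other rising factorial, and the alternating sum telescopes. -/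
theorem mul_betaSum_separatingCofactor (m N : ℕ) :
    (2 * m + 2 + N : ℚ) * betaSum N (separatingCofactor (m + 1) N) =
      N.factorial * ((m + 2).ascFactorial (N + 1) + (-1) ^ N * m.ascFactorial (N + 1)) := by
  have h := Finset.sum_range_sub' (fun i => (-1 : ℚ) ^ i * m.ascFactorial i *
    (m + 2).ascFactorial (N + 1 - i)) (N + 1)
  rw [betaSum, Finset.mul_sum]
  have h1 : ∀ i ∈ range (N + 1), (2 * m + 2 + N : ℚ) *
      ((i.factorial * (N - i).factorial : ℚ) * (separatingCofactor (m + 1) N).coeff i) =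
      N.factorial * ((-1 : ℚ) ^ i * m.ascFactorial i * (m + 2).ascFactorial (N + 1 - i) -
        (-1 : ℚ) ^ (i + 1) * m.ascFactorial (i + 1) *
          (m + 2).ascFactorial (N + 1 - (i + 1))) := by
    intro i hi
    have hi : i ≤ N := by have := mem_range.1 hi; omega
    rw [coeff_separatingCofactor, ← Nat.choose_mul_factorial_mul_factorial hi, Nat.succ_sub hi,
      Nat.add_sub_add_right, Nat.ascFactorial_succ, Nat.ascFactorial_succ]
    push_cast [hi]
    ring
  rw [Finset.sum_congr rfl h1, ← Finset.mul_sum, h]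
  simp [pow_succ]

end BetaSum

/-! ### The count of pairs and the probability -/

section Counting

open Polynomial

variable {α : Type*} [Fintype α] [DecidableEq α]

theorem sum_borderedPoly_separating {A : Finset α} {m : ℕ} (hA : A.card = m + 1) :
    ∑ w ∈ separating A univ, borderedPoly w = C (Fintype.card α : ℚ) * X *
      ((1 + X) ^ m * separatingCofactor (m + 1) (Fintype.card α - (m + 1))) := by
  -- Cancelling `1 + X` uses up one factor of `(1 + X) ^ (m + 1)`, which is why `A` must be
  -- nonempty.
  have h0 : (1 + X : ℚ[X]) ≠ 0 := by
    intro h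
    simpa using congrArg (eval 0) h
  refine mul_left_cancel₀ h0 ?_
  rw [Finset.mul_sum, Finset.sum_congr rfl fun w _ => one_add_X_mul_borderedPoly w,
    ← Finset.mul_sum, sum_signPoly_separating, hA, pow_succ]
  ring

theorem mul_sum_separating_indicator {A : Finset α} {m N : ℕ} (hA : A.card = m + 1)
    (hN : Fintype.card α = N + m + 1) :
    (N + 1 : ℚ) * ((2 * m + 2 + N) * ∑ w ∈ separating A univ, ∑ u ∈ longCycles α,
      (if u * w ∈ longCycles α then 1 else 0)) =
      (N + m).factorial * ((m + 2).ascFactorial (N + 1) + (-1) ^ N * m.ascFactorial (N + 1)) := by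
  set S : ℚ := ∑ w ∈ separating A univ, ∑ u ∈ longCycles α,
      (if u * w ∈ longCycles α then 1 else 0) with hS
  have h1 : (((N + m : ℕ) : ℚ) + 1) ^ 2 * S = (((N + m : ℕ) : ℚ) + 1) *
      betaSum (N + m) ((1 + X) ^ m * separatingCofactor (m + 1) N) := by
    rw [hS, Finset.mul_sum, Finset.sum_congr rfl fun w _ => card_sq_mul_sum_indicator hN w,
      Finset.sum_comm, betaSum, Finset.mul_sum]
    refine Finset.sum_congr rfl fun k _ => ?_
    rw [← Finset.mul_sum, ← finsetSum_coeff, sum_borderedPoly_separating hA, mul_assoc (C _),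
      coeff_C_mul, coeff_X_mul, hN, show N + m + 1 - (m + 1) = N by omega]
    push_cast
    ring
  have h2 := factorial_mul_betaSum (natDegree_separatingCofactor m N) m
  have h3 := mul_betaSum_separatingCofactor m N
  have h4 : (((N + m : ℕ) : ℚ) + 1) ≠ 0 := by positivity
  have h5 : (((N + m : ℕ) : ℚ) + 1) * S =
      betaSum (N + m) ((1 + X) ^ m * separatingCofactor (m + 1) N) := by
    refine mul_left_cancel₀ h4 ?_
    rw [← h1]; ring
  have h6 : (N.factorial : ℚ) ≠ 0 := by positivity
  rw [← h5, Nat.factorial_succ, Nat.factorial_succ] at h2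
  push_cast at h2 h4
  refine mul_left_cancel₀ h6 (mul_left_cancel₀ h4 ?_)
  linear_combination (2 * m + 2 + N : ℚ) * h2 + (N + m + 1 : ℚ) * (N + m).factorial * h3

end Counting

theorem nCycles_eq (n : ℕ) : nCycles n = longCycles (Fin n) := rfl

-- The change of variables is `u = α⁻¹`, `w = αβ`, so that `β = u * w`; inverses of long cycles are
-- long cycles.
open Classical in
theorem card_separates_eq (n m : ℕ) :
    (((nCycles n ×ˢ nCycles n).filter fun p => Separates m (p.1 * p.2)).card : ℚ) =
      ∑ w ∈ separating (univ.filter fun i : Fin n => i.val < m) univ, ∑ u ∈ longCycles (Fin n),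
        (if u * w ∈ longCycles (Fin n) then 1 else 0) := by
  have hsep : ∀ w : Perm (Fin n), w ∈ separating (univ.filter fun i : Fin n => i.val < m) univ ↔
      Separates m w := by
    intro w
    simp only [mem_separating, mem_univ, not_true, false_imp_iff, implies_true, true_and,
      mem_filter, Separates]
    exact ⟨fun h i j hi hj => h i hi j hj, fun h i hi j hj => h i j hi hj⟩
  rw [nCycles_eq, Finset.card_filter, Finset.sum_product]
  push_cast
  refine Eq.trans ?_ Finset.sum_comm
  refine Finset.sum_equiv (Equiv.inv (Perm (Fin n))) (fun u => by simp [inv_mem_longCycles]) ?_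
  intro a _
  have h1 : ∑ b ∈ longCycles (Fin n), (if Separates m (a * b) then (1 : ℚ) else 0) =
      ∑ b : Perm (Fin n), if b ∈ longCycles (Fin n) ∧ Separates m (a * b) then 1 else 0 := by
    simp_rw [ite_and]
    rw [Finset.sum_ite_mem, univ_inter]
  have h2 : ∑ w ∈ separating (univ.filter fun i : Fin n => i.val < m) univ,
      (if a⁻¹ * w ∈ longCycles (Fin n) then (1 : ℚ) else 0) =
      ∑ w : Perm (Fin n), if Separates m w ∧ a⁻¹ * w ∈ longCycles (Fin n) then 1 else 0 := by
    simp_rw [ite_and, ← hsep]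
    rw [Finset.sum_ite_mem, univ_inter]
  refine h1.trans (Eq.trans ?_ h2.symm)
  refine Finset.sum_equiv (Equiv.mulLeft a) (by simp) fun b _ => ?_
  simp [and_comm]

theorem invFactorial_sub_one (m : ℕ) : invFactorial ((m : ℤ) - 1) = m / m.factorial := by
  cases m with
  | zero => simp [invFactorial]
  | succ m =>
    have h : ¬ (((m + 1 : ℕ) : ℤ) - 1 < 0) := by omega
    have h2 : (((m + 1 : ℕ) : ℤ) - 1).toNat = m := by omega
    rw [invFactorial, if_neg h, h2, Nat.factorial_succ]
    push_cast
    field_simp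

open Classical in
theorem separationProbability_zero {n : ℕ} (hn : 1 ≤ n) : separationProbability n 0 = 1 := by
  have : Nonempty (Fin n) := ⟨⟨0, hn⟩⟩
  rw [separationProbability, Finset.filter_true_of_mem (by intro p _ i j hi; omega)]
  refine div_self ?_
  rw [nCycles_eq, card_product, card_longCycles]
  positivity

theorem separationProbability_succ (N m : ℕ) :
    separationProbability (N + m + 1) (m + 1) = 1 / ((m + 1).factorial : ℚ) +
      (1 + (-1) ^ N) * invFactorial ((m : ℤ) - 1) / ((N + 1) * (N + m + 1 + (m + 1))) := by
  have hA : (univ.filter fun i : Fin (N + m + 1) => i.val < m + 1).card = m + 1 := by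
    rw [Fin.card_filter_val_lt]; omega
  have h := mul_sum_separating_indicator hA (N := N) (by simp)
  rw [← card_separates_eq, nCycles_eq] at h
  rw [separationProbability, invFactorial_sub_one, card_product, nCycles_eq, card_longCycles,
    Fintype.card_fin, Nat.add_sub_cancel]
  have h1 := Nat.factorial_mul_ascFactorial (m + 1) (N + 1)
  have h2 := Nat.factorial_mul_ascFactorial m N
  have h3 : m.ascFactorial (N + 1) = m * (m + 1).ascFactorial N := by
    rw [Nat.ascFactorial_succ, Nat.succ_ascFactorial]
  rw [h3] at h
  have h4 : (m + 1 + (N + 1)).factorial = (N + m + 2) * ((N + m + 1) * (N + m).factorial) := by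
    rw [show m + 1 + (N + 1) = N + m + 1 + 1 by ring, Nat.factorial_succ, Nat.factorial_succ]
  rw [h4, Nat.factorial_succ] at h1
  rw [add_comm m N] at h2
  have h1' := congrArg (Nat.cast : ℕ → ℚ) h1
  have h2' := congrArg (Nat.cast : ℕ → ℚ) h2
  rw [Nat.factorial_succ]
  push_cast at h h1' h2' ⊢
  have hF : (m.factorial : ℚ) ≠ 0 := by positivity
  have hm : (m + 1 : ℚ) ≠ 0 := by positivity
  have hN : (N + 1 : ℚ) ≠ 0 := by positivity
  have hK : (2 * m + 2 + N : ℚ) ≠ 0 := by positivity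
  rw [show (N + m + 1 + (m + 1) : ℚ) = 2 * m + 2 + N by ring]
  have ha := (eq_div_iff (mul_ne_zero hm hF)).2 ((mul_comm _ _).trans h1')
  have hb := (eq_div_iff hF).2 ((mul_comm _ _).trans h2')
  rw [ha, hb, ← mul_assoc] at h
  rw [(eq_div_iff (mul_ne_zero hN hK)).2 ((mul_comm _ _).trans h)]
  -- What remains is `(N + m + 1) (N + m + 2) = (N + 1) (N + 2m + 2) + m (m + 1)`, which splits off
  -- the term `1 / (m + 1)!`.
  field_simp
  ring

end

theorem mainTheorem2 (n m : ℕ) (hn : 1 ≤ n) (hmn : m ≤ n) :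
    (Odd (n - m) →
      separationProbability n m = 1 / (m.factorial : ℚ)) ∧
    (Even (n - m) →
      separationProbability n m =
        1 / (m.factorial : ℚ) +
          2 * invFactorial ((m : ℤ) - 2) / (((n : ℚ) + 1 - m) * ((n : ℚ) + m))) := by
  cases m with
  | zero => simp [separationProbability_zero hn, invFactorial]
  | succ m =>
    obtain ⟨N, rfl⟩ : ∃ N, n = N + m + 1 := ⟨n - (m + 1), by omega⟩
    have e : N + m + 1 - (m + 1) = N := by omega
    have e2 : ((m + 1 : ℕ) : ℤ) - 2 = m - 1 := by push_cast; ring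
    rw [e, e2, separationProbability_succ]
    refine ⟨fun h => by simp [h.neg_one_pow], fun h => ?_⟩
    rw [h.neg_one_pow]
    push_cast
    congr 3
    · norm_num
    · ring
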